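/- All spaces are real Banach spaces. A boundary of a Banach space $X$ is a subset $B$ of the closed unit ball of the dual $X^*$ such that for every $x\in X$ there is $\xi\in B$ with $\xi(x)=\|x\|$. For $k\in\{1,2,\dots\}\cup\{\infty\}$, a Banach space $X$ is said to admit a $C^k$ renorming if there is a norm on $X$, equivalent to the given one, which is a function of class $C^k$ (in the Fréchet sense) on $X\setminus\{0\}$. For Banach spaces $X$ and $E$, the injective tensor product $X\otimes_\epsilon E$ is the completion of the algebraic tensor product of $X$ and $E$ for the norm $$\|z\|_\epsilon=\sup\{|(\xi\otimes\eta)(z)| : \xi\in X^*,\ \eta\in E^*,\ \|\xi\|\le 1,\ \|\eta\|\le 1\},$$ where $(\xi\otimes\eta)\bigl(\sum_j x_j\otimes e_j\bigr)=\sum_j \xi(x_j)\,\eta(e_j)$. **Corollary 2 (Hájek).** Let $X$ be a Banach space which admits a countable boundary. Then $X$ admits a $C^\infty$ renorming. Moreover, for every $k\in\{1,2,\dots\}\cup\{\infty\}$ and every Banach space $E$ which admits a $C^k$ renorming, the injective tensor product $X\otimes_\epsilon E$ admits a $C^k$ renorming. -/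

import Mathlib

open scoped TensorProduct

noncomputable section

/-- A boundary of a real normed space `X`: a subset of the closed unit ball of the dual on which
every element of `X` attains its norm. -/
def IsBoundary {X : Type*} [NormedAddCommGroup X] [NormedSpace ℝ X]
    (B : Set (StrongDual ℝ X)) : Prop :=
  (∀ ξ ∈ B, ‖ξ‖ ≤ 1) ∧ ∀ x : X, ∃ ξ ∈ B, ξ x = ‖x‖

/-- `X` admits a `C^k` renorming: there is an equivalent norm on `X` which is (Fréchet) of
class `C^k` on `X \ {0}`. The lower bound makes the seminorm `p` a norm. -/
def AdmitsRenorming (k : ℕ∞) (X : Type*) [NormedAddCommGroup X] [NormedSpace ℝ X] : Prop :=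
  ∃ p : Seminorm ℝ X,
    (∃ c C : ℝ, 0 < c ∧ 0 < C ∧ ∀ x : X, c * ‖x‖ ≤ p x ∧ p x ≤ C * ‖x‖) ∧
    ContDiffOn ℝ (k : WithTop ℕ∞) (fun x : X => p x) {x : X | x ≠ 0}

section InjectiveTensor

variable (X E : Type*) [NormedAddCommGroup X] [NormedSpace ℝ X]
  [NormedAddCommGroup E] [NormedSpace ℝ E]

/-- The algebraic tensor product of `X` and `E`, to be normed by the injective norm. -/
def AlgTensor : Type _ := X ⊗[ℝ] E

instance : AddCommGroup (AlgTensor X E) := inferInstanceAs (AddCommGroup (X ⊗[ℝ] E))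

instance : Module ℝ (AlgTensor X E) := inferInstanceAs (Module ℝ (X ⊗[ℝ] E))

variable {X E}

/-- The elementary tensor `x ⊗ e`. -/
def AlgTensor.tmul (x : X) (e : E) : AlgTensor X E := x ⊗ₜ[ℝ] e

/-- The linear form `ξ ⊗ η`, with `(ξ ⊗ η) (∑ xⱼ ⊗ eⱼ) = ∑ ξ xⱼ * η eⱼ`. -/
def tensorForm (ξ : StrongDual ℝ X) (η : StrongDual ℝ E) : AlgTensor X E →ₗ[ℝ] ℝ :=
  TensorProduct.lift ((LinearMap.mul ℝ ℝ).compl₁₂ (ξ : X →ₗ[ℝ] ℝ) (η : E →ₗ[ℝ] ℝ))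

theorem tensorForm_tmul (ξ : StrongDual ℝ X) (η : StrongDual ℝ E) (x : X) (e : E) :
    tensorForm ξ η (AlgTensor.tmul x e) = ξ x * η e := rfl

/-- The injective norm: the supremum of `|(ξ ⊗ η) z|` over the closed dual unit balls. -/
def injectiveNorm (z : AlgTensor X E) : ℝ :=
  ⨆ q : Metric.closedBall (0 : StrongDual ℝ X) 1 × Metric.closedBall (0 : StrongDual ℝ E) 1,
    |tensorForm q.1.1 q.2.1 z|

theorem bddAbove_tensorForm (z : AlgTensor X E) :
    BddAbove (Set.range fun q : Metric.closedBall (0 : StrongDual ℝ X) 1 ×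
      Metric.closedBall (0 : StrongDual ℝ E) 1 => |tensorForm q.1.1 q.2.1 z|) := by
  suffices h : ∃ C : ℝ, ∀ (ξ : StrongDual ℝ X) (η : StrongDual ℝ E), ‖ξ‖ ≤ 1 → ‖η‖ ≤ 1 →
      |tensorForm ξ η z| ≤ C by
    obtain ⟨C, hC⟩ := h
    refine ⟨C, ?_⟩
    rintro _ ⟨⟨⟨ξ, hξ⟩, ⟨η, hη⟩⟩, rfl⟩
    exact hC ξ η (by simpa using hξ) (by simpa using hη)
  refine TensorProduct.induction_on (motive := fun w : X ⊗[ℝ] E => ∃ C : ℝ,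
    ∀ (ξ : StrongDual ℝ X) (η : StrongDual ℝ E), ‖ξ‖ ≤ 1 → ‖η‖ ≤ 1 →
      |tensorForm ξ η (w : AlgTensor X E)| ≤ C) z ?_ ?_ ?_
  · exact ⟨0, fun ξ η _ _ => by rw [show tensorForm ξ η (0 : X ⊗[ℝ] E) = 0 from map_zero _]; simp⟩
  · intro x e
    refine ⟨‖x‖ * ‖e‖, fun ξ η hξ hη => ?_⟩
    have h1 : |ξ x| ≤ ‖x‖ := (ξ.le_of_opNorm_le hξ x).trans_eq (one_mul _)
    have h2 : |η e| ≤ ‖e‖ := (η.le_of_opNorm_le hη e).trans_eq (one_mul _)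
    rw [show tensorForm ξ η (x ⊗ₜ[ℝ] e) = ξ x * η e from rfl, abs_mul]
    exact mul_le_mul h1 h2 (abs_nonneg _) (norm_nonneg _)
  · rintro u v ⟨C, hC⟩ ⟨D, hD⟩
    refine ⟨C + D, fun ξ η hξ hη => ?_⟩
    rw [show tensorForm ξ η (u + v) = tensorForm ξ η u + tensorForm ξ η v from map_add _ _ _]
    exact (abs_add_le _ _).trans (add_le_add (hC ξ η hξ hη) (hD ξ η hξ hη))

instance : Nonempty (Metric.closedBall (0 : StrongDual ℝ X) 1 ×
    Metric.closedBall (0 : StrongDual ℝ E) 1) :=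
  ⟨⟨⟨0, by simp⟩, ⟨0, by simp⟩⟩⟩

theorem injectiveNorm_add_le (z w : AlgTensor X E) :
    injectiveNorm (z + w) ≤ injectiveNorm z + injectiveNorm w := by
  refine ciSup_le fun q => ?_
  rw [map_add]
  exact (abs_add_le _ _).trans
    (add_le_add (le_ciSup (bddAbove_tensorForm z) q) (le_ciSup (bddAbove_tensorForm w) q))

theorem injectiveNorm_smul (a : ℝ) (z : AlgTensor X E) :
    injectiveNorm (a • z) = |a| * injectiveNorm z := by
  unfold injectiveNorm
  rw [Real.mul_iSup_of_nonneg (abs_nonneg a)]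
  simp only [map_smul, smul_eq_mul, abs_mul]

variable (X E)

/-- The injective norm, bundled. -/
def injectiveSeminorm : Seminorm ℝ (AlgTensor X E) :=
  Seminorm.of injectiveNorm injectiveNorm_add_le injectiveNorm_smul

instance : SeminormedAddCommGroup (AlgTensor X E) :=
  (injectiveSeminorm X E).toAddGroupSeminorm.toSeminormedAddCommGroup

instance : NormedSpace ℝ (AlgTensor X E) where
  norm_smul_le a z := (injectiveNorm_smul a z).le

/-- The injective tensor product of `X` and `E`: the completion of the algebraic tensor product
for the injective norm. -/
abbrev InjectiveTensorProduct : Type _ := UniformSpace.Completion (AlgTensor X E)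

end InjectiveTensor

end

/-! Let `ξ n` enumerate the boundary and let `p` be the `C^k` norm on `E`. Slicing by `ξ n` gives
operators `T n` into `E`, and `q y = sup_n p (T n y)` is an equivalent norm whose supremum is
attained at every `y`. Attainment is a duality argument (`exists_leftSlice_max`): the `p`-dual ball
is weak* compact, `η ↦ ‖rightSlice η y‖` has a maximum on it, and some `ξ n` norms the maximising
slice. An attained supremum can be smoothed (`AdmitsRenorming.of_attained`). Set `F = ∑ φ n (p (T n
y))`, with `φ n` convex, zero up to a threshold `b n < 1`, `b n → 1`, and `φ n 1 = 2`. In the open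
ball `q < 1` the sum is locally finite, hence convex and `C^k`; on each ray the attaining index
pushes `F` above 1 before `q` reaches 1. The gauge of `{F < 1}` is then the required norm, `C^k` by
the implicit function theorem (`AdmitsRenorming.of_convexOn_ball`). -/

open Filter Topology ContDiff in
-- A rescaled primitive of `expNegInvGlue`: that integrand is nonnegative and increasing, so the
-- primitive is monotone and convex.
theorem exists_contDiff_convex_transition : ∃ ψ : ℝ → ℝ, ContDiff ℝ ∞ ψ ∧ ConvexOn ℝ Set.univ ψ ∧
    Monotone ψ ∧ (∀ t ≤ 0, ψ t = 0) ∧ ψ 1 = 2 := by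
  have hc : Continuous expNegInvGlue := (expNegInvGlue.contDiff (n := 0)).continuous
  set g : ℝ → ℝ := fun t => ∫ s in (0:ℝ)..t, expNegInvGlue s with hg
  have hd : ∀ t, HasDerivAt g (expNegInvGlue t) t := fun t =>
    intervalIntegral.integral_hasDerivAt_right (hc.intervalIntegrable _ _)
      (hc.stronglyMeasurableAtFilter _ _) hc.continuousAt
  have hderiv : deriv g = expNegInvGlue := funext fun t => (hd t).deriv
  have hdiff : Differentiable ℝ g := fun t => (hd t).differentiableAt
  have hmono : Monotone g := monotone_of_deriv_nonneg hdiff fun t => by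
    rw [hderiv]; exact expNegInvGlue.nonneg t
  have hsm : ContDiff ℝ ∞ g := by
    rw [contDiff_infty_iff_deriv, hderiv]
    exact ⟨hdiff, expNegInvGlue.contDiff⟩
  have hzero : ∀ t ≤ 0, g t = 0 := by
    intro t ht
    have : g t = ∫ s in (0:ℝ)..t, (0 : ℝ) := by
      refine intervalIntegral.integral_congr fun s hs => ?_
      rw [Set.uIcc_of_ge ht] at hs
      exact expNegInvGlue.zero_of_nonpos hs.2
    simpa using this
  have hpos : 0 < g 1 := by
    refine intervalIntegral.intervalIntegral_pos_of_pos_on (hc.intervalIntegrable _ _) ?_ one_pos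
    exact fun x hx => expNegInvGlue.pos_of_pos hx.1
  have hconv : ConvexOn ℝ Set.univ g := by
    refine MonotoneOn.convexOn_of_deriv convex_univ hdiff.continuous.continuousOn
      hdiff.differentiableOn ?_
    rw [hderiv]
    exact expNegInvGlue.monotone.monotoneOn _
  refine ⟨fun t => (2 / g 1) * g t, contDiff_const.mul hsm, ?_, ?_, ?_, ?_⟩
  · exact hconv.smul (by positivity)
  · exact hmono.const_mul (by positivity)
  · intro t ht
    simp [hzero t ht]
  · field_simp

theorem Seminorm.continuous_of_le_mul_norm {E : Type*} [SeminormedAddCommGroup E]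
    [NormedSpace ℝ E] (p : Seminorm ℝ E) {C : ℝ} (hC : 0 ≤ C) (h : ∀ x, p x ≤ C * ‖x‖) :
    Continuous p := by
  refine (LipschitzWith.of_dist_le_mul (K := ⟨C, hC⟩) fun x y => ?_).continuous
  rw [Real.dist_eq, dist_eq_norm]
  exact (abs_sub_map_le_sub p x y).trans (h _)

/-! ### Smoothness of gauges of convex sublevel sets. -/

section Gauge

variable {Y : Type*} [NormedAddCommGroup Y] [NormedSpace ℝ Y]

/-- The implicit function theorem for gauges: if `F` is convex and `C^k` near `z`, with
`F 0 = 0` and `F z = 1`, then the equation `F (r • y) = 1` has a `C^k` solution near `z`. -/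
theorem exists_contDiffAt_radial [CompleteSpace Y] {k : ℕ∞} (hk : 1 ≤ k) {D : Set Y}
    (hD : IsOpen D) {F : Y → ℝ} (hF : ContDiffOn ℝ k F D) (hconv : ConvexOn ℝ D F)
    (h0 : (0 : Y) ∈ D) (hF0 : F 0 = 0) {y : Y} {r : ℝ} (hr : 0 < r) (hy : r • y ∈ D)
    (hFy : F (r • y) = 1) :
    ∃ ρ : Y → ℝ, ρ y = r ∧ ContDiffAt ℝ k ρ y ∧ ∀ᶠ x in nhds y, F (ρ x • x) = 1 := by
  have hk0 : (k : WithTop ℕ∞) ≠ 0 := by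
    intro h
    have : k = 0 := by exact_mod_cast h
    simp [this] at hk
  set G : Y × ℝ → ℝ := fun v => F (v.2 • v.1) with hG
  have hFc : ContDiffAt ℝ k F (r • y) := hF.contDiffAt (hD.mem_nhds hy)
  have hGc : ContDiffAt ℝ k G (y, r) :=
    ContDiffAt.comp (y, r) (g := F) (f := fun v : Y × ℝ => v.2 • v.1) hFc
      (contDiffAt_snd.smul contDiffAt_fst)
  have hGd : DifferentiableAt ℝ G (y, r) := hGc.differentiableAt hk0
  set a : ℝ := fderiv ℝ G (y, r) (0, 1) with ha
  have hline : HasDerivAt (fun t : ℝ => F (t • y)) a r := by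
    have h2 : HasDerivAt (fun t : ℝ => ((y, t) : Y × ℝ)) (0, 1) r :=
      (hasDerivAt_const r y).prodMk (hasDerivAt_id r)
    exact HasFDerivAt.comp_hasDerivAt r hGd.hasFDerivAt h2
  have hcv : ConvexOn ℝ ((fun t : ℝ => t • y) ⁻¹' D) (fun t : ℝ => F (t • y)) :=
    hconv.comp_linearMap (LinearMap.toSpanSingleton ℝ Y y)
  -- By convexity the radial derivative at `r` is at least the chord slope `1 / r` from 0, so the
  -- implicit function theorem applies.
  have hapos : 0 < a := by
    have := hcv.slope_le_of_hasDerivAt (x := 0) (y := r) (by simpa using h0) hy hr hline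
    refine lt_of_lt_of_le ?_ this
    simp only [slope_def_field, hFy, zero_smul, hF0]
    simpa using hr
  have hinv : (fderiv ℝ G (y, r) ∘L .inr ℝ Y ℝ).IsInvertible := by
    refine ⟨ContinuousLinearEquiv.unitsEquivAut ℝ (Units.mk0 a hapos.ne'), ?_⟩
    ext
    simp [ha]
  refine ⟨hGc.implicitFunction hk0 hinv, ?_, ?_, ?_⟩
  · exact hGc.implicitFunction_apply_self hk0 hinv
  · exact hGc.contDiffAt_implicitFunction hk0 hinv
  · filter_upwards [hGc.eventually_apply_implicitFunction hk0 hinv] with x hx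
    simpa [hG, hFy] using hx

/-- If the gauge `g` exceeded 1, convexity would give `F (g⁻¹ • z) ≤ g⁻¹ < 1`, putting a point of
gauge 1 in an open convex set whose points have gauge below 1. -/
theorem gauge_eq_one_of_convexOn {D : Set Y} {F : Y → ℝ} (hconv : ConvexOn ℝ D F)
    (hs : IsOpen {y ∈ D | F y < 1}) (h0 : (0 : Y) ∈ D) (hF0 : F 0 = 0) {z : Y} (hz : z ∈ D)
    (hFz : F z = 1) : gauge {y ∈ D | F y < 1} z = 1 := by
  have h0s : (0 : Y) ∈ {y ∈ D | F y < 1} := ⟨h0, by simp [hF0]⟩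
  have hsc : Convex ℝ {y ∈ D | F y < 1} := hconv.convex_lt 1
  have hlt := setOfPred_gauge_lt_one_eq_self_of_isOpen hsc h0s hs
  apply le_antisymm
  · by_contra! h
    set g := gauge {y ∈ D | F y < 1} z with hg
    have hg0 : 0 < g := one_pos.trans h
    have ht1 : g⁻¹ < 1 := inv_lt_one_of_one_lt₀ h
    have hmem : g⁻¹ • z ∈ {y ∈ D | F y < 1} := by
      have h1 : (1 - g⁻¹) • (0 : Y) + g⁻¹ • z = g⁻¹ • z := by simp
      have ha : 0 ≤ 1 - g⁻¹ := by linarith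
      have hb : 0 ≤ g⁻¹ := by positivity
      have hab : 1 - g⁻¹ + g⁻¹ = 1 := by ring
      refine ⟨h1 ▸ hconv.1 h0 hz ha hb hab, ?_⟩
      have := hconv.2 h0 hz ha hb hab
      rw [h1, hF0, hFz] at this
      simp only [smul_eq_mul] at this
      linarith
    rw [← hlt] at hmem
    have h2 : gauge {y ∈ D | F y < 1} (g⁻¹ • z) < 1 := hmem
    rw [gauge_smul_of_nonneg (by positivity : 0 ≤ g⁻¹), ← hg, smul_eq_mul,
      inv_mul_cancel₀ hg0.ne'] at h2
    exact lt_irrefl _ h2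
  · by_contra! h
    have : z ∈ {y ∈ D | F y < 1} := by rw [← hlt]; exact h
    exact absurd this.2 (by simp [hFz])

/-- The set `{F < 1}` lies between the `q`-balls of radii `δ` and 1, which gives equivalence. `hbig`
makes every ray meet `{F = 1}` inside the open ball, where `F` is smooth. -/
theorem AdmitsRenorming.of_convexOn_ball [CompleteSpace Y] {k : ℕ∞} (hk : 1 ≤ k)
    (q : Seminorm ℝ Y) {c C : ℝ} (hc : 0 < c) (hC : 0 < C) (hcq : ∀ y, c * ‖y‖ ≤ q y)
    (hqC : ∀ y, q y ≤ C * ‖y‖) {F : Y → ℝ} (hF : ContDiffOn ℝ k F (q.ball 0 1))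
    (hconv : ConvexOn ℝ (q.ball 0 1) F) (heven : ∀ y, F (-y) = F y) (hF0 : F 0 = 0)
    {δ : ℝ} (hδ : 0 < δ) (hδ1 : δ < 1) (hsmall : ∀ y, q y < δ → F y < 1)
    (hbig : ∀ y, y ≠ 0 → ∃ r : ℝ, 0 < r ∧ r * q y < 1 ∧ 1 < F (r • y)) :
    AdmitsRenorming k Y := by
  have hqcont : Continuous q := q.continuous_of_le_mul_norm hC.le hqC
  have hDo : IsOpen (q.ball 0 1) := by
    have : q.ball 0 1 = q ⁻¹' Set.Iio 1 := by ext; simp [Seminorm.mem_ball]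
    rw [this]; exact isOpen_Iio.preimage hqcont
  have h0 : (0 : Y) ∈ q.ball 0 1 := by simp [Seminorm.mem_ball]
  set s : Set Y := {y ∈ q.ball 0 1 | F y < 1} with hsdef
  have hso : IsOpen s := hF.continuousOn.isOpen_inter_preimage hDo isOpen_Iio
  have h0s : (0 : Y) ∈ s := ⟨h0, by simp [hF0]⟩
  have hsc : Convex ℝ s := hconv.convex_lt 1
  have hneg : ∀ x ∈ s, -x ∈ s := fun x hx =>
    ⟨by simpa [Seminorm.mem_ball] using hx.1, by simpa [heven] using hx.2⟩
  have habs : Absorbent ℝ s := absorbent_nhds_zero (hso.mem_nhds h0s)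
  have hbal : Balanced ℝ s := (balanced_iff_neg_mem hsc).2 fun x hx => hneg x hx
  have hgauge : ∀ y : Y, y ≠ 0 → ∃ r : ℝ, 0 < r ∧ r • y ∈ q.ball 0 1 ∧ F (r • y) = 1 := by
    intro y hy
    obtain ⟨R, hR0, hR1, hRF⟩ := hbig y hy
    have hmem : ∀ t ∈ Set.Icc 0 R, t • y ∈ q.ball 0 1 := by
      intro t ht
      rw [Seminorm.mem_ball, sub_zero, map_smul_eq_mul, Real.norm_of_nonneg ht.1]
      exact (mul_le_mul_of_nonneg_right ht.2 (apply_nonneg q y)).trans_lt hR1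
    have hcont : ContinuousOn (fun t : ℝ => F (t • y)) (Set.Icc 0 R) :=
      hF.continuousOn.comp (by fun_prop) hmem
    obtain ⟨r, hr, hFr⟩ := intermediate_value_Icc hR0.le hcont
      (show (1 : ℝ) ∈ Set.Icc _ _ from ⟨by simp [hF0], hRF.le⟩)
    refine ⟨r, hr.1.lt_of_ne ?_, hmem r hr, hFr⟩
    rintro rfl
    simp [hF0] at hFr
  have hval : ∀ (y : Y) (r : ℝ), 0 < r → r • y ∈ q.ball 0 1 → F (r • y) = 1 →
      gauge s y = r⁻¹ := by
    intro y r hr hy hFy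
    have := gauge_eq_one_of_convexOn hconv hso h0 hF0 hy hFy
    rw [gauge_smul_of_nonneg hr.le, smul_eq_mul] at this
    exact eq_inv_of_mul_eq_one_right this
  refine ⟨gaugeSeminorm hbal hsc habs, ⟨c, 2 / δ * C, hc, by positivity, fun y => ⟨?_, ?_⟩⟩, ?_⟩
  · refine (hcq y).trans ?_
    rw [← Seminorm.gauge_ball q]
    exact gauge_mono habs (fun y hy => hy.1) y
  · have hle : gauge s y ≤ 2 / δ * q y := by
      rcases eq_or_ne y 0 with rfl | hy
      · simp
      have hqpos : 0 < q y := (mul_pos hc (norm_pos_iff.2 hy)).trans_le (hcq y)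
      refine gauge_le_of_mem (by positivity) ?_
      rw [Set.mem_smul_set_iff_inv_smul_mem₀ (by positivity)]
      have : q ((2 / δ * q y)⁻¹ • y) = δ / 2 := by
        rw [map_smul_eq_mul, Real.norm_of_nonneg (by positivity)]
        field_simp
      exact ⟨by rw [Seminorm.mem_ball, sub_zero, this]; linarith,
        hsmall _ (by rw [this]; linarith)⟩
    refine hle.trans ?_
    rw [mul_assoc]
    exact mul_le_mul_of_nonneg_left (hqC y) (by positivity)
  · intro y hy
    refine ContDiffAt.contDiffWithinAt ?_
    obtain ⟨r, hr, hry, hFr⟩ := hgauge y hy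
    obtain ⟨ρ, hρ, hρs, hρF⟩ := exists_contDiffAt_radial hk hDo hF hconv h0 hF0 hr hry hFr
    have hρ0 : ρ y ≠ 0 := by rw [hρ]; exact hr.ne'
    -- Near `y` the gauge is the inverse of the radial solution `ρ`.
    refine (hρs.inv hρ0).congr_of_eventuallyEq ?_
    have h1 : ∀ᶠ x in nhds y, 0 < ρ x :=
      hρs.continuousAt.eventually (lt_mem_nhds (by rw [hρ]; exact hr))
    have h2 : ∀ᶠ x in nhds y, ρ x • x ∈ q.ball 0 1 :=
      (hρs.continuousAt.smul continuousAt_id).eventually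
        (hDo.mem_nhds (by simpa [hρ] using hry))
    filter_upwards [h1, h2, hρF] with x hx1 hx2 hx3
    exact hval x _ hx1 hx2 hx3

end Gauge

/-! ### Smoothing an attained supremum. -/

/-- A supremum of seminorms `p ∘ T n` which is attained at every point, and is an equivalent norm,
gives rise to a `C^k` renorming as soon as `p` is `C^k` away from zero. -/
theorem AdmitsRenorming.of_attained {Y E : Type*} [NormedAddCommGroup Y] [NormedSpace ℝ Y]
    [CompleteSpace Y] [NormedAddCommGroup E] [NormedSpace ℝ E] {k : ℕ∞} (hk : 1 ≤ k)
    (p : Seminorm ℝ E) {A : ℝ} (hA : 0 ≤ A) (hpA : ∀ e, p e ≤ A * ‖e‖)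
    (hp : ContDiffOn ℝ k (fun e => p e) {e | e ≠ 0}) (T : ℕ → Y →L[ℝ] E) {c C : ℝ} (hc : 0 < c)
    (hC : 0 < C) (hTC : ∀ n y, p (T n y) ≤ C * ‖y‖)
    (hT : ∀ y, ∃ n, (∀ m, p (T m y) ≤ p (T n y)) ∧ c * ‖y‖ ≤ p (T n y)) :
    AdmitsRenorming k Y := by
  obtain ⟨ψ, hψs, hψc, hψm, hψ0, hψ1⟩ := exists_contDiff_convex_transition
  have hψnn : ∀ t, 0 ≤ ψ t := fun t => by
    rcases le_total t 0 with ht | ht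
    · exact (hψ0 t ht).ge
    · exact (hψ0 0 le_rfl).ge.trans (hψm ht)
  have hpc : Continuous p := p.continuous_of_le_mul_norm hA hpA
  -- the attained supremum as a seminorm
  have hbdd : ∀ y, BddAbove (Set.range fun n => p (T n y)) := fun y =>
    ⟨C * ‖y‖, by rintro _ ⟨n, rfl⟩; exact hTC n y⟩
  obtain ⟨q, hqle, hqatt⟩ : ∃ q : Seminorm ℝ Y, (∀ n y, p (T n y) ≤ q y) ∧
      ∀ y, ∃ n, q y = p (T n y) := by
    refine ⟨Seminorm.of (fun y => ⨆ n, p (T n y)) ?_ ?_, fun n y => le_ciSup (hbdd y) n, ?_⟩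
    · intro x y
      refine ciSup_le fun n => ?_
      rw [map_add]
      exact (map_add_le_add p _ _).trans (add_le_add (le_ciSup (hbdd x) n) (le_ciSup (hbdd y) n))
    · intro a y
      rw [Real.mul_iSup_of_nonneg (norm_nonneg a)]
      simp only [map_smul, map_smul_eq_mul]
    · intro y
      obtain ⟨n, hn, -⟩ := hT y
      exact ⟨n, le_antisymm (ciSup_le hn) (le_ciSup (hbdd y) n)⟩
  have hcq : ∀ y, c * ‖y‖ ≤ q y := fun y => by
    obtain ⟨n, -, hn⟩ := hT y
    exact hn.trans (hqle n y)
  have hqC : ∀ y, q y ≤ C * ‖y‖ := fun y => by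
    obtain ⟨n, hn⟩ := hqatt y
    exact hn ▸ hTC n y
  have hqcont : Continuous q := q.continuous_of_le_mul_norm hC.le hqC
  -- The exponent `n + 1` keeps every threshold at least `1 / 2`, so all summands vanish where `q ≤
  -- 1 / 2`.
  set b : ℕ → ℝ := fun n => 1 - (1 / 2) ^ (n + 1) with hb
  have hb_half : ∀ n, 1 / 2 ≤ b n := fun n => by
    have : (1 / 2 : ℝ) ^ (n + 1) ≤ 1 / 2 := by
      simpa using pow_le_pow_of_le_one (by norm_num : (0 : ℝ) ≤ 1 / 2) (by norm_num)
        (Nat.le_add_left 1 n)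
    simp only [hb]; linarith
  have hb_tendsto : Filter.Tendsto b Filter.atTop (nhds 1) := by
    have : Filter.Tendsto (fun n : ℕ => (1 / 2 : ℝ) ^ (n + 1)) Filter.atTop (nhds 0) :=
      (tendsto_pow_atTop_nhds_zero_of_lt_one (by norm_num) (by norm_num)).comp
        (Filter.tendsto_add_atTop_nat 1)
    simpa [hb] using this.const_sub 1
  -- The affine change of variable carries `[b n, 1]` onto `[0, 1]`.
  set φ : ℕ → ℝ → ℝ := fun n t => ψ ((t - b n) * 2 ^ (n + 1)) with hφ
  have hφs : ∀ n, ContDiff ℝ k (φ n) := fun n =>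
    (hψs.of_le (by exact_mod_cast le_top)).comp ((contDiff_id.sub contDiff_const).mul contDiff_const)
  have hφ0 : ∀ n t, t ≤ b n → φ n t = 0 := fun n t ht =>
    hψ0 _ (mul_nonpos_of_nonpos_of_nonneg (by linarith) (by positivity))
  have hφ1 : ∀ n, φ n 1 = 2 := fun n => by
    have : (1 - b n) * 2 ^ (n + 1) = 1 := by
      simp only [hb, sub_sub_cancel, ← mul_pow]
      norm_num
    simp only [hφ, this, hψ1]
  have hφm : ∀ n, Monotone (φ n) := fun n s t hst => hψm (by gcongr)
  have hφc : ∀ n, ConvexOn ℝ Set.univ (φ n) := fun n => by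
    refine ⟨convex_univ, fun s _ t _ α β hα hβ hαβ => ?_⟩
    refine le_trans (le_of_eq ?_) (hψc.2 (Set.mem_univ ((s - b n) * 2 ^ (n + 1)))
      (Set.mem_univ ((t - b n) * 2 ^ (n + 1))) hα hβ hαβ)
    obtain rfl : β = 1 - α := by linarith
    simp only [hφ, smul_eq_mul]
    congr 1
    ring
  set f : ℕ → Y → ℝ := fun n y => φ n (p (T n y)) with hf
  have hfnn : ∀ n y, 0 ≤ f n y := fun n y => hψnn _
  have hf0 : ∀ n y, q y ≤ b n → f n y = 0 := fun n y h => hφ0 n _ ((hqle n y).trans h)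
  have hfs : ∀ n, ContDiff ℝ k (f n) := by
    intro n
    rw [contDiff_iff_contDiffAt]
    intro y
    -- Where `T n y = 0`, smoothness of `p` is not available, but `φ n` vanishes on a neighbourhood
    -- of the value 0.
    by_cases hy : T n y = 0
    · refine (contDiffAt_const (c := (0 : ℝ))).congr_of_eventuallyEq ?_
      have : ∀ᶠ x in nhds y, p (T n x) < b n := by
        refine (hpc.comp (T n).continuous).continuousAt.eventually (gt_mem_nhds ?_)
        simp only [Function.comp_apply, hy, map_zero]
        linarith [hb_half n]
      filter_upwards [this] with x hx
      exact hφ0 n _ hx.le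
    · have h1 : ContDiffAt ℝ k (fun e => p e) (T n y) :=
        hp.contDiffAt (isOpen_ne.mem_nhds hy)
      exact (hφs n).contDiffAt.comp y (h1.comp y (T n).contDiff.contDiffAt)
  have hfc : ∀ n, ConvexOn ℝ Set.univ (f n) := by
    intro n
    refine ⟨convex_univ, fun x _ y _ α β hα hβ hαβ => ?_⟩
    refine le_trans (hφm n ?_) ((hφc n).2 (Set.mem_univ _) (Set.mem_univ _) hα hβ hαβ)
    rw [map_add, map_smul, map_smul]
    refine (map_add_le_add p _ _).trans (le_of_eq ?_)
    simp [map_smul_eq_mul, abs_of_nonneg hα, abs_of_nonneg hβ]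
  have hloc : ∀ ρ < 1, ∃ N, ∀ n, N ≤ n → ρ < b n := fun ρ hρ =>
    Filter.eventually_atTop.1 (hb_tendsto.eventually (lt_mem_nhds hρ))
  have hsum : ∀ y, q y < 1 → Summable fun n => f n y := by
    intro y hy
    obtain ⟨N, hN⟩ := hloc _ hy
    refine summable_of_ne_finset_zero (s := Finset.range N) fun n hn => hf0 n y ?_
    exact (hN n (by simpa using hn)).le
  have hball : ∀ y, y ∈ q.ball 0 1 ↔ q y < 1 := fun y => by simp [Seminorm.mem_ball]
  refine AdmitsRenorming.of_convexOn_ball hk q hc hC hcq hqC (F := fun y => ∑' n, f n y)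
    (δ := 1 / 2) ?_ ?_ ?_ ?_ (by norm_num) (by norm_num) ?_ ?_
  · intro y hy
    rw [hball] at hy
    obtain ⟨ρ, hyρ, hρ⟩ := exists_between hy
    obtain ⟨N, hN⟩ := hloc _ hρ
    refine ContDiffAt.contDiffWithinAt ?_
    have hs : ContDiffAt ℝ k (fun y => ∑ n ∈ Finset.range N, f n y) y :=
      (ContDiff.sum fun n _ => hfs n).contDiffAt
    refine hs.congr_of_eventuallyEq ?_
    filter_upwards [hqcont.continuousAt.eventually (gt_mem_nhds hyρ)] with x hx
    refine tsum_eq_sum fun n hn => hf0 n x ?_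
    exact hx.le.trans (hN n (by simpa using hn)).le
  · refine ⟨q.convex_ball 0 1, fun x hx y hy α β hα hβ hαβ => ?_⟩
    have hxy := (hball _).1 (q.convex_ball 0 1 hx hy hα hβ hαβ)
    rw [hball] at hx hy
    have hx' := (hsum x hx).mul_left α
    have hy' := (hsum y hy).mul_left β
    simp only [smul_eq_mul]
    rw [← tsum_mul_left, ← tsum_mul_left, ← hx'.tsum_add hy']
    exact (hsum _ hxy).tsum_le_tsum
      (fun n => (hfc n).2 (Set.mem_univ x) (Set.mem_univ y) hα hβ hαβ) (hx'.add hy')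
  · intro y
    simp [hf]
  · refine (tsum_congr fun n => hf0 n 0 ?_).trans tsum_zero
    rw [map_zero]; linarith [hb_half n]
  · intro y hy
    have : ∑' n, f n y = 0 :=
      (tsum_congr fun n => hf0 n y (hy.le.trans (hb_half n))).trans tsum_zero
    simp [this]
  · intro y hy
    -- Attainment is decisive here: along the ray the `n`-th summand alone is `φ n u` with `u = q`,
    -- which exceeds 1 for some `u < 1` because `φ n 1 = 2`.
    obtain ⟨n, hn⟩ := hqatt y
    have hqpos : 0 < q y := (mul_pos hc (norm_pos_iff.2 hy)).trans_le (hcq y)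
    have hcont : ContinuousAt (φ n) 1 := (hφs n).continuous.continuousAt
    have hev : ∀ᶠ u in nhdsWithin (1 : ℝ) (Set.Iio 1), 1 < φ n u ∧ 0 < u ∧ u < 1 := by
      refine Filter.Eventually.and (nhdsWithin_le_nhds
        (hcont.eventually (lt_mem_nhds (by rw [hφ1]; norm_num)))) (Filter.Eventually.and
        (nhdsWithin_le_nhds (lt_mem_nhds one_pos)) self_mem_nhdsWithin)
    obtain ⟨u, hu1, hu0, hu⟩ := hev.exists
    have hrq : u / q y * q y = u := div_mul_cancel₀ u hqpos.ne'
    refine ⟨u / q y, by positivity, by rwa [hrq], ?_⟩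
    have hq' : q ((u / q y) • y) = u := by
      rw [map_smul_eq_mul, Real.norm_of_nonneg (by positivity), hrq]
    have hfu : f n ((u / q y) • y) = φ n u := by
      simp only [hf, map_smul, map_smul_eq_mul]
      rw [← hn, Real.norm_of_nonneg (by positivity), hrq]
    calc 1 < f n ((u / q y) • y) := by rwa [hfu]
      _ ≤ ∑' n, f n ((u / q y) • y) :=
        (hsum _ (by rwa [hq'])).le_tsum n fun m _ => hfnn m _

/-- The scalar case `T n = ξ n`: the absolute value on `ℝ` is smooth off 0, and the boundary
property is exactly attainment. -/
theorem AdmitsRenorming.of_countable_isBoundary {X : Type*} [NormedAddCommGroup X]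
    [NormedSpace ℝ X] [CompleteSpace X] {ξ : ℕ → StrongDual ℝ X}
    (hξ : IsBoundary (Set.range ξ)) : AdmitsRenorming ⊤ X := by
  have hle : ∀ n x, |ξ n x| ≤ ‖x‖ := fun n x =>
    ((ξ n).le_of_opNorm_le (hξ.1 _ ⟨n, rfl⟩) x).trans_eq (one_mul _)
  refine AdmitsRenorming.of_attained le_top (normSeminorm ℝ ℝ) zero_le_one (fun e => by simp) ?_ ξ
    one_pos one_pos (fun n x => by simpa using hle n x) fun x => ?_
  · exact fun e he => (contDiffAt_norm ℝ he).contDiffWithinAt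
  · obtain ⟨_, ⟨n, rfl⟩, hn⟩ := hξ.2 x
    refine ⟨n, fun m => ?_, ?_⟩
    · simpa [hn] using hle m x
    · simp [hn]

/-- Hahn–Banach, extending `a • e ↦ a * p e` from the line through `e`. -/
theorem Seminorm.exists_strongDual_eq {E : Type*} [NormedAddCommGroup E] [NormedSpace ℝ E]
    (p : Seminorm ℝ E) {A : ℝ} (hpA : ∀ e, p e ≤ A * ‖e‖) (e : E) :
    ∃ η : StrongDual ℝ E, (∀ x, |η x| ≤ p x) ∧ η e = p e := by
  rcases eq_or_ne e 0 with rfl | he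
  · exact ⟨0, fun x => by simp, by simp⟩
  have hle : ∀ x : (ℝ ∙ e), (LinearPMap.mkSpanSingleton (σ := RingHom.id ℝ) e (p e) he).toFun x
      ≤ p x := by
    rintro ⟨x, hx⟩
    obtain ⟨a, rfl⟩ := Submodule.mem_span_singleton.1 hx
    refine (LinearPMap.mkSpanSingleton'_apply (σ := RingHom.id ℝ) e (p e) _ a hx).trans_le ?_
    simp only [RingHom.id_apply, smul_eq_mul, map_smul_eq_mul]
    exact mul_le_mul_of_nonneg_right (le_abs_self a) (apply_nonneg p e)
  obtain ⟨g, hg, hgp⟩ := Module.Dual.exists_extension_of_le_seminorm_real (ℝ ∙ e) _ hle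
  refine ⟨g.mkContinuous A fun x => (hgp x).trans (hpA x), hgp, ?_⟩
  refine (hg ⟨e, Submodule.mem_span_singleton_self e⟩).trans ?_
  exact LinearPMap.mkSpanSingleton_apply ℝ ℝ he (p e)

/-! ### Slice maps on the algebraic tensor product. -/

namespace AlgTensor

variable {X E : Type*} [NormedAddCommGroup X] [NormedSpace ℝ X]
  [NormedAddCommGroup E] [NormedSpace ℝ E]

/-- The slice map `x ⊗ e ↦ ξ x • e`. -/
def leftSlice (ξ : StrongDual ℝ X) : AlgTensor X E →ₗ[ℝ] E :=
  TensorProduct.lift (LinearMap.lsmul ℝ E ∘ₗ (ξ : X →ₗ[ℝ] ℝ))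

/-- The slice map `x ⊗ e ↦ η e • x`. -/
def rightSlice (η : StrongDual ℝ E) : AlgTensor X E →ₗ[ℝ] X :=
  TensorProduct.lift (LinearMap.lsmul ℝ X ∘ₗ (η : E →ₗ[ℝ] ℝ)).flip

theorem leftSlice_tmul (ξ : StrongDual ℝ X) (x : X) (e : E) :
    leftSlice ξ (tmul x e) = ξ x • e := rfl

theorem rightSlice_tmul (η : StrongDual ℝ E) (x : X) (e : E) :
    rightSlice η (tmul x e) = η e • x := rfl

theorem induction {P : AlgTensor X E → Prop} (z : AlgTensor X E) (zero : P 0)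
    (tmul : ∀ x e, P (tmul x e)) (add : ∀ u v, P u → P v → P (u + v)) : P z :=
  TensorProduct.induction_on (motive := P) z zero tmul add

theorem apply_leftSlice (ξ : StrongDual ℝ X) (η : StrongDual ℝ E) (z : AlgTensor X E) :
    η (leftSlice ξ z) = tensorForm ξ η z := by
  induction z using induction with
  | zero => simp
  | tmul x e => simp [leftSlice_tmul, tensorForm_tmul]
  | add u v hu hv => simp [hu, hv]

theorem apply_rightSlice (ξ : StrongDual ℝ X) (η : StrongDual ℝ E) (z : AlgTensor X E) :
    ξ (rightSlice η z) = tensorForm ξ η z := by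
  induction z using induction with
  | zero => simp
  | tmul x e => simp [rightSlice_tmul, tensorForm_tmul, mul_comm]
  | add u v hu hv => simp [hu, hv]

theorem rightSlice_smul (a : ℝ) (η : StrongDual ℝ E) (z : AlgTensor X E) :
    rightSlice (a • η) z = a • rightSlice η z := by
  induction z using induction with
  | zero => simp
  | tmul x e => simp [rightSlice_tmul, mul_smul]
  | add u v hu hv => simp [hu, hv]

theorem abs_tensorForm_le (ξ : StrongDual ℝ X) (η : StrongDual ℝ E) (z : AlgTensor X E) :
    |tensorForm ξ η z| ≤ ‖ξ‖ * ‖η‖ * ‖z‖ := by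
  rcases eq_or_ne ξ 0 with rfl | hξ
  · simp [← apply_rightSlice]
  rcases eq_or_ne η 0 with rfl | hη
  · simp [← apply_leftSlice]
  have hξ' := norm_pos_iff.2 hξ
  have hη' := norm_pos_iff.2 hη
  have h := le_ciSup (bddAbove_tensorForm z)
    ⟨⟨‖ξ‖⁻¹ • ξ, by simp [norm_smul, hξ]⟩, ⟨‖η‖⁻¹ • η, by simp [norm_smul, hη]⟩⟩
  have he : tensorForm (‖ξ‖⁻¹ • ξ) (‖η‖⁻¹ • η) z = (‖ξ‖ * ‖η‖)⁻¹ * tensorForm ξ η z := by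
    rw [← apply_rightSlice, rightSlice_smul, map_smul, smul_apply,
      apply_rightSlice, smul_eq_mul, smul_eq_mul, mul_inv]
    ring
  simp only [he] at h
  rw [abs_mul, abs_of_pos (by positivity), inv_mul_le_iff₀ (by positivity)] at h
  exact h

theorem norm_leftSlice_le (ξ : StrongDual ℝ X) (z : AlgTensor X E) :
    ‖leftSlice ξ z‖ ≤ ‖ξ‖ * ‖z‖ :=
  NormedSpace.norm_le_dual_bound ℝ _ (by positivity) fun η => by
    rw [apply_leftSlice]
    exact (abs_tensorForm_le ξ η z).trans_eq (by ring)

theorem norm_rightSlice_le (η : StrongDual ℝ E) (z : AlgTensor X E) :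
    ‖rightSlice η z‖ ≤ ‖η‖ * ‖z‖ :=
  NormedSpace.norm_le_dual_bound ℝ _ (by positivity) fun ξ => by
    rw [apply_rightSlice]
    exact (abs_tensorForm_le ξ η z).trans_eq (by ring)

theorem norm_le_of_rightSlice {z : AlgTensor X E} {M : ℝ}
    (h : ∀ η : StrongDual ℝ E, ‖η‖ ≤ 1 → ‖rightSlice η z‖ ≤ M) : ‖z‖ ≤ M := by
  refine ciSup_le fun q => ?_
  have hξ : ‖q.1.1‖ ≤ 1 := mem_closedBall_zero_iff.1 q.1.2
  have hη : ‖q.2.1‖ ≤ 1 := mem_closedBall_zero_iff.1 q.2.2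
  rw [← apply_rightSlice]
  exact (q.1.1.le_of_opNorm_le hξ _).trans ((one_mul _).trans_le (h _ hη))

/-- Weak*-to-norm continuity holds because the slice is a finite sum of terms `η e • x`. -/
theorem continuous_rightSlice (z : AlgTensor X E) :
    Continuous fun η : WeakDual ℝ E => rightSlice (WeakDual.toStrongDual η) z := by
  induction z using induction with
  | zero => simpa using continuous_const
  | tmul x e =>
    simp only [rightSlice_tmul]
    exact (WeakDual.eval_continuous e).smul continuous_const
  | add u v hu hv =>
    simp only [map_add]
    exact hu.add hv

end AlgTensor

/-! ### Slice maps on the completion, and attainment of the supremum. -/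

namespace InjectiveTensorProduct

open UniformSpace

variable {X E : Type*} [NormedAddCommGroup X] [NormedSpace ℝ X]
  [NormedAddCommGroup E] [NormedSpace ℝ E]

theorem denseRange_toComplL :
    DenseRange ((Completion.toComplL : AlgTensor X E →L[ℝ] InjectiveTensorProduct X E) :
      AlgTensor X E →ₗ[ℝ] InjectiveTensorProduct X E) :=
  Completion.denseRange_coe

theorem exists_norm_sub_coe_lt (y : InjectiveTensorProduct X E) {ε : ℝ} (hε : 0 < ε) :
    ∃ z : AlgTensor X E, ‖y - z‖ < ε := by
  obtain ⟨z, hz⟩ := Completion.denseRange_coe.exists_dist_lt y hε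
  exact ⟨z, by rwa [← dist_eq_norm]⟩

/-- The continuous extension of `x ⊗ e ↦ ξ x • e`. -/
noncomputable def leftSlice [CompleteSpace E] (ξ : StrongDual ℝ X) : InjectiveTensorProduct X E →L[ℝ] E :=
  (AlgTensor.leftSlice ξ).extendOfNorm
    ((Completion.toComplL : AlgTensor X E →L[ℝ] InjectiveTensorProduct X E) :
      AlgTensor X E →ₗ[ℝ] InjectiveTensorProduct X E)

/-- The continuous extension of `x ⊗ e ↦ η e • x`. -/
noncomputable def rightSlice [CompleteSpace X] (η : StrongDual ℝ E) : InjectiveTensorProduct X E →L[ℝ] X :=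
  (AlgTensor.rightSlice η).extendOfNorm
    ((Completion.toComplL : AlgTensor X E →L[ℝ] InjectiveTensorProduct X E) :
      AlgTensor X E →ₗ[ℝ] InjectiveTensorProduct X E)

section

variable [CompleteSpace E]

theorem leftSlice_coe (ξ : StrongDual ℝ X) (z : AlgTensor X E) :
    leftSlice ξ (z : InjectiveTensorProduct X E) = AlgTensor.leftSlice ξ z :=
  LinearMap.extendOfNorm_eq denseRange_toComplL
    ⟨‖ξ‖, fun z => (AlgTensor.norm_leftSlice_le ξ z).trans_eq
      (congrArg _ (Completion.norm_coe z).symm)⟩ z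

theorem norm_leftSlice_apply_le (ξ : StrongDual ℝ X) (y : InjectiveTensorProduct X E) :
    ‖leftSlice ξ y‖ ≤ ‖ξ‖ * ‖y‖ :=
  LinearMap.norm_extendOfNorm_apply_le denseRange_toComplL _
    (fun z => (AlgTensor.norm_leftSlice_le ξ z).trans_eq
      (congrArg _ (Completion.norm_coe z).symm)) y

end

section

variable [CompleteSpace X]

theorem rightSlice_coe (η : StrongDual ℝ E) (z : AlgTensor X E) :
    rightSlice η (z : InjectiveTensorProduct X E) = AlgTensor.rightSlice η z :=
  LinearMap.extendOfNorm_eq denseRange_toComplL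
    ⟨‖η‖, fun z => (AlgTensor.norm_rightSlice_le η z).trans_eq
      (congrArg _ (Completion.norm_coe z).symm)⟩ z

theorem rightSlice_smul (a : ℝ) (η : StrongDual ℝ E) (y : InjectiveTensorProduct X E) :
    rightSlice (a • η) y = a • rightSlice η y := by
  induction y using Completion.induction_on with
  | hp => exact isClosed_eq (by fun_prop) (by fun_prop)
  | ih z => rw [rightSlice_coe, rightSlice_coe, AlgTensor.rightSlice_smul]

theorem norm_rightSlice_apply_le (η : StrongDual ℝ E) (y : InjectiveTensorProduct X E) :
    ‖rightSlice η y‖ ≤ ‖η‖ * ‖y‖ :=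
  LinearMap.norm_extendOfNorm_apply_le denseRange_toComplL _
    (fun z => (AlgTensor.norm_rightSlice_le η z).trans_eq
      (congrArg _ (Completion.norm_coe z).symm)) y

theorem norm_rightSlice_sub_coe_le {η : StrongDual ℝ E} {A : ℝ} (hη : ‖η‖ ≤ A)
    (y : InjectiveTensorProduct X E) (z : AlgTensor X E) :
    ‖rightSlice η y - AlgTensor.rightSlice η z‖ ≤ A * ‖y - z‖ := by
  rw [← rightSlice_coe, ← map_sub]
  exact (norm_rightSlice_apply_le η _).trans (mul_le_mul_of_nonneg_right hη (norm_nonneg _))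

theorem norm_le_of_rightSlice {y : InjectiveTensorProduct X E} {M : ℝ}
    (h : ∀ η : StrongDual ℝ E, ‖η‖ ≤ 1 → ‖rightSlice η y‖ ≤ M) : ‖y‖ ≤ M := by
  refine le_of_forall_pos_le_add fun ε hε => ?_
  obtain ⟨z, hz⟩ := exists_norm_sub_coe_lt y (half_pos hε)
  have h1 : ‖z‖ ≤ M + ε / 2 := AlgTensor.norm_le_of_rightSlice fun η hη => by
    have h2 := norm_rightSlice_sub_coe_le hη y z
    have h3 := norm_le_insert (rightSlice η y) (AlgTensor.rightSlice η z)
    have h4 := h η hη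
    linarith
  have h5 : ‖y‖ ≤ ‖(z : InjectiveTensorProduct X E)‖ + ‖y - z‖ :=
    norm_le_norm_add_norm_sub' _ _
  rw [Completion.norm_coe] at h5
  linarith

/-- On a norm-bounded set of functionals, the slices of `y` are uniform limits of slices of
algebraic tensors. -/
theorem continuousOn_rightSlice {W : Set (WeakDual ℝ E)} {A : ℝ} (hA : 0 < A)
    (hW : ∀ η ∈ W, ‖WeakDual.toStrongDual η‖ ≤ A) (y : InjectiveTensorProduct X E) :
    ContinuousOn (fun η : WeakDual ℝ E => rightSlice (WeakDual.toStrongDual η) y) W := by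
  refine continuousOn_of_uniform_approx_of_continuousOn fun u hu => ?_
  obtain ⟨ε, hε, hεu⟩ := Metric.mem_uniformity_dist.1 hu
  obtain ⟨z, hz⟩ := exists_norm_sub_coe_lt y (div_pos hε hA)
  refine ⟨_, (AlgTensor.continuous_rightSlice z).continuousOn, fun η hη => hεu ?_⟩
  rw [dist_eq_norm]
  refine (norm_rightSlice_sub_coe_le (hW η hη) y z).trans_lt ?_
  rwa [lt_div_iff₀' hA] at hz

end

variable [CompleteSpace X] [CompleteSpace E]

theorem apply_leftSlice (ξ : StrongDual ℝ X) (η : StrongDual ℝ E)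
    (y : InjectiveTensorProduct X E) : η (leftSlice ξ y) = ξ (rightSlice η y) := by
  induction y using Completion.induction_on with
  | hp => exact isClosed_eq (by fun_prop) (by fun_prop)
  | ih z => rw [leftSlice_coe, rightSlice_coe, AlgTensor.apply_leftSlice,
      AlgTensor.apply_rightSlice]

/-- If `ξ` enumerates a boundary of `X`, the seminorms `p (leftSlice (ξ n) y)` attain their
supremum at each `y`, and this supremum dominates the injective norm. -/
theorem exists_leftSlice_max {ξ : ℕ → StrongDual ℝ X} (hξ : IsBoundary (Set.range ξ))
    (p : Seminorm ℝ E) {c A : ℝ} (hc : 0 < c) (hA : 0 < A) (hcp : ∀ e, c * ‖e‖ ≤ p e)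
    (hpA : ∀ e, p e ≤ A * ‖e‖) (y : InjectiveTensorProduct X E) :
    ∃ n, (∀ m, p (leftSlice (ξ m) y) ≤ p (leftSlice (ξ n) y)) ∧
      c * ‖y‖ ≤ p (leftSlice (ξ n) y) := by
  -- The dual unit ball for `p` rather than for the given norm, so that `p` is the supremum of its
  -- functionals.
  set W : Set (WeakDual ℝ E) := {η | ∀ e, |η e| ≤ p e} with hWdef
  have hWA : ∀ η ∈ W, ‖WeakDual.toStrongDual η‖ ≤ A := fun η hη =>
    ContinuousLinearMap.opNorm_le_bound _ hA.le fun e => (hη e).trans (hpA e)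
  have hWclosed : IsClosed W := by
    rw [hWdef, Set.ofPred_forall]
    exact isClosed_iInter fun e =>
      isClosed_le (WeakDual.eval_continuous e).abs continuous_const
  have hWcompact : IsCompact W :=
    (WeakDual.isCompact_closedBall (0 : StrongDual ℝ E) A).of_isClosed_subset hWclosed
      fun η hη => mem_closedBall_zero_iff.2 (hWA η hη)
  obtain ⟨η₀, hη₀, hmax⟩ := hWcompact.exists_isMaxOn (f := fun η : WeakDual ℝ E =>
    ‖rightSlice (WeakDual.toStrongDual η) y‖) ⟨0, fun e => abs_zero.trans_le (apply_nonneg p e)⟩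
    (continuousOn_rightSlice hA hWA y).norm
  obtain ⟨_, ⟨n, rfl⟩, hn⟩ := hξ.2 (rightSlice (WeakDual.toStrongDual η₀) y)
  have hle : ‖rightSlice (WeakDual.toStrongDual η₀) y‖ ≤ p (leftSlice (ξ n) y) := by
    rw [← hn, ← apply_leftSlice]
    exact (le_abs_self _).trans (hη₀ _)
  refine ⟨n, fun m => ?_, ?_⟩
  -- With `η` in `W` norming this slice for `p`, its seminorm is `ξ m (rightSlice η y)`, at most the
  -- maximum over `W`.
  · obtain ⟨η, hη, hηe⟩ := p.exists_strongDual_eq hpA (leftSlice (ξ m) y)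
    rw [← hηe, apply_leftSlice]
    refine (le_abs_self _).trans (((ξ m).le_of_opNorm_le (hξ.1 _ ⟨m, rfl⟩) _).trans ?_)
    rw [one_mul]
    exact (hmax (show StrongDual.toWeakDual η ∈ W from hη)).trans hle
  · refine le_trans ?_ hle
    rw [← le_div_iff₀' hc]
    refine norm_le_of_rightSlice fun η hη => ?_
    rw [le_div_iff₀' hc]
    -- Since `c * ‖e‖ ≤ p e`, `W` contains `c` times the original dual ball; this yields the lower
    -- bound.
    have hmem : StrongDual.toWeakDual (c • η) ∈ W := fun e => by
      change |c * η e| ≤ p e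
      rw [abs_mul, abs_of_pos hc]
      refine le_trans (mul_le_mul_of_nonneg_left ?_ hc.le) (hcp e)
      exact (η.le_of_opNorm_le hη e).trans_eq (one_mul _)
    have := hmax hmem
    change ‖rightSlice (c • η) y‖ ≤ _ at this
    rwa [rightSlice_smul, norm_smul, Real.norm_of_nonneg hc.le] at this

theorem admitsRenorming {ξ : ℕ → StrongDual ℝ X} (hξ : IsBoundary (Set.range ξ)) {k : ℕ∞}
    (hk : 1 ≤ k) (hE : AdmitsRenorming k E) :
    AdmitsRenorming k (InjectiveTensorProduct X E) := by
  obtain ⟨p, ⟨c, A, hc, hA, hp⟩, hps⟩ := hE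
  refine AdmitsRenorming.of_attained hk p hA.le (fun e => (hp e).2) hps (fun n => leftSlice (ξ n))
    hc hA (fun n y => ?_)
    (exists_leftSlice_max hξ p hc hA (fun e => (hp e).1) fun e => (hp e).2)
  refine ((hp _).2).trans (mul_le_mul_of_nonneg_left ?_ hA.le)
  exact (norm_leftSlice_apply_le _ y).trans
    (mul_le_of_le_one_left (norm_nonneg y) (hξ.1 _ ⟨n, rfl⟩))

end InjectiveTensorProduct

theorem corollary2 (X : Type*) [NormedAddCommGroup X] [NormedSpace ℝ X] [CompleteSpace X]
    (hX : ∃ B : Set (StrongDual ℝ X), B.Countable ∧ IsBoundary B) :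
    AdmitsRenorming ⊤ X ∧
      ∀ (k : ℕ∞), 1 ≤ k →
        ∀ (E : Type*) [NormedAddCommGroup E] [NormedSpace ℝ E] [CompleteSpace E],
          AdmitsRenorming k E → AdmitsRenorming k (InjectiveTensorProduct X E) := by
  obtain ⟨B, hBc, hB⟩ := hX
  -- Norming the vector 0 shows that `B` is nonempty, so `ℕ` enumerates it, possibly with
  -- repetitions.
  obtain ⟨ξ₀, hξ₀, -⟩ := hB.2 0
  obtain ⟨ξ, rfl⟩ := hBc.exists_eq_range ⟨ξ₀, hξ₀⟩
  exact ⟨AdmitsRenorming.of_countable_isBoundary hB, fun k hk E _ _ _ hE =>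
    InjectiveTensorProduct.admitsRenorming hB hk hE⟩
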